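/- All C$^*$-algebras are unital. Let $\mathscr A,\mathscr B$ be C$^*$-algebras and let $\mathscr A\otimes\mathscr B$ be a C$^*$-tensor product of them, i.e. the completion of the algebraic tensor product with respect to a C$^*$-norm (any C$^*$-norm is allowed). Write $\mathscr S(\cdot)$ for the set of states (normalized positive linear functionals); for $\rho\in\mathscr S(\mathscr A)$ and $\tau\in\mathscr S(\mathscr B)$ let $\rho\otimes\tau$ be the unique state on $\mathscr A\otimes\mathscr B$ with $(\rho\otimes\tau)(A\otimes B)=\rho(A)\tau(B)$. For a state $\omega$ and an element $Y$ of the same algebra with $\omega(Y^\dagger Y)\neq 0$, the reduced state $\omega_Y$ is defined by $\omega_Y(X)=\omega(Y^\dagger XY)/\omega(Y^\dagger Y)$. **Proposition (Generalized Reduction).** Let $\mathbf P\in\mathscr A$ and $\mathbf Q\in\mathscr A\otimes\mathscr B$ be projections (self-adjoint idempotents), let $\alpha$ be a $*$-automorphism of $\mathscr A\otimes\mathscr B$, let $\tau\in\mathscr S(\mathscr B)$, and for $\rho\in\mathscr S(\mathscr A)$ put $\mathbf M^*(\rho)=\alpha^*(\rho\otimes\tau)=(\rho\otimes\tau)\circ\alpha$.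 Suppose that $\Delta\ge 0$ satisfies $|\mathbf M^*(\rho)(\mathbf Q)-\rho(\mathbf P)|\le\Delta$ for all $\rho\in\mathscr S(\mathscr A)$. Then for every $\rho\in\mathscr S(\mathscr A)$ with $\rho(\mathbf P)\neq 0$ and $\mathbf M^*(\rho)(\mathbf Q)\neq 0$ (so that both reduced states below exist), $$ \big\|(\mathbf M^*(\rho))_{\mathbf Q}-\mathbf M^*(\rho_{\mathbf P})\big\|\le \frac{\sqrt\Delta}{\mathbf M^*(\rho)(\mathbf Q)}\Big(1+2\sqrt\Delta+\sqrt{1+(1+2\sqrt\Delta)^2}\Big), $$ where $\|\cdot\|$ is the norm of the dual space of $\mathscr A\otimes\mathscr B$. -/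

import Mathlib

open scoped TensorProduct ComplexOrder

/-- A state on a unital C⋆-algebra: a positive linear functional `ρ` with `ρ 1 = 1`.
(Positive functionals are automatically continuous, so asking for continuity is harmless.) -/
structure CStarState (A : Type*) [CStarAlgebra A] where
  toDual : StrongDual ℂ A
  nonneg' : ∀ a : A, 0 ≤ toDual (star a * a)
  map_one' : toDual 1 = 1

theorem isClosed_forall_aux {X : Type*} [TopologicalSpace X] {ι : Sort*} {p : ι → X → Prop}
    (h : ∀ i, IsClosed {x | p i x}) : IsClosed {x | ∀ i, p i x} := by
  rw [Set.ofPred_forall]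
  exact isClosed_iInter h

namespace CStarState

noncomputable instance (A : Type*) [CStarAlgebra A] : FunLike (CStarState A) A ℂ where
  coe ρ := ρ.toDual
  coe_injective := by
    rintro ⟨f, _, _⟩ ⟨g, _, _⟩ h
    have : f = g := DFunLike.coe_injective h
    subst this
    rfl

section

variable {A : Type*} [CStarAlgebra A]

@[simp] theorem toDual_apply (ρ : CStarState A) (a : A) : ρ.toDual a = ρ a := rfl

@[simp] theorem coe_mk (f : StrongDual ℂ A) (h₁ h₂) (a : A) :
    (CStarState.mk f h₁ h₂ : CStarState A) a = f a := rfl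

@[ext] theorem ext {ρ σ : CStarState A} (h : ∀ a, ρ a = σ a) : ρ = σ := DFunLike.ext _ _ h

instance : ContinuousLinearMapClass (CStarState A) ℂ A ℂ where
  map_add ρ := map_add ρ.toDual
  map_smulₛₗ ρ := map_smul ρ.toDual
  map_continuous ρ := ρ.toDual.continuous

theorem star_mul_self_nonneg (ρ : CStarState A) (a : A) : 0 ≤ ρ (star a * a) := ρ.nonneg' a

@[simp] theorem map_one (ρ : CStarState A) : ρ 1 = 1 := ρ.map_one'

/-- The reduced state `ρ_Y(a) = ρ(Y⋆ a Y) / ρ(Y⋆ Y)`, defined whenever `ρ(Y⋆ Y) ≠ 0`. -/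
noncomputable def reduced (ρ : CStarState A) (Y : A) (h : ρ (star Y * Y) ≠ 0) :
    CStarState A where
  toDual := (ρ (star Y * Y))⁻¹ • ρ.toDual ∘L ContinuousLinearMap.mulLeftRight ℂ A (star Y) Y
  nonneg' a := by
    have h₁ := ρ.star_mul_self_nonneg (a * Y)
    have h₂ : 0 ≤ (ρ (star Y * Y))⁻¹ := inv_nonneg.2 (ρ.star_mul_self_nonneg Y)
    simpa [mul_assoc] using mul_nonneg h₂ h₁
  map_one' := by simp [h]

theorem reduced_apply (ρ : CStarState A) (Y : A) (h : ρ (star Y * Y) ≠ 0) (a : A) :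
    ρ.reduced Y h a = ρ (star Y * a * Y) / ρ (star Y * Y) := by
  simp [reduced, div_eq_inv_mul]

/-- The dual action `π^*(σ) = σ ∘ π` of a unital ⋆-homomorphism on states. -/
noncomputable def comap {B : Type*} [CStarAlgebra B] (π : A →⋆ₐ[ℂ] B) (σ : CStarState B) :
    CStarState A where
  toDual := ⟨σ.toDual.toLinearMap ∘ₗ π.toAlgHom.toLinearMap,
    σ.toDual.continuous.comp
      (NonUnitalStarAlgHom.instContinuousLinearMapClassComplex.map_continuous π)⟩
  nonneg' a := by
    have := σ.star_mul_self_nonneg (π a)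
    rw [← map_star, ← map_mul] at this
    exact this
  map_one' := by
    change σ (π 1) = 1
    simp

@[simp] theorem comap_apply {B : Type*} [CStarAlgebra B] (π : A →⋆ₐ[ℂ] B) (σ : CStarState B)
    (a : A) : comap π σ a = σ (π a) := rfl

theorem map_nonneg [PartialOrder A] [StarOrderedRing A] (ρ : CStarState A) {a : A}
    (ha : 0 ≤ a) : 0 ≤ ρ a := by
  obtain ⟨b, rfl⟩ := CStarAlgebra.nonneg_iff_eq_star_mul_self.1 ha
  exact ρ.star_mul_self_nonneg b

theorem map_algebraMap (ρ : CStarState A) (r : ℝ) : ρ (algebraMap ℝ A r) = (r : ℂ) := by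
  rw [IsScalarTower.algebraMap_apply ℝ ℂ A, Algebra.algebraMap_eq_smul_one, map_smul]
  simp

theorem map_star (ρ : CStarState A) (a : A) : ρ (star a) = (starRingEnd ℂ) (ρ a) := by
  have key : ∀ x : A, IsSelfAdjoint x → (ρ x).im = 0 := by
    intro x hx
    let _ := CStarAlgebra.spectralOrder A
    let _ := CStarAlgebra.spectralOrderedRing A
    have h := (Complex.le_def.1 (ρ.map_nonneg (sub_nonneg.2 hx.le_algebraMap_norm_self))).2
    rw [map_sub, ρ.map_algebraMap] at h
    simpa using h
  have h₁ := key (a + star a) (IsSelfAdjoint.add_star_self a)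
  have h₂ := key (Complex.I • (a - star a)) (by
    rw [IsSelfAdjoint, star_smul, star_sub, star_star]
    simp [smul_sub, neg_add_eq_sub])
  rw [map_add, Complex.add_im] at h₁
  rw [map_smul, map_sub] at h₂
  simp at h₂
  apply Complex.ext
  · rw [Complex.conj_re]; linarith
  · rw [Complex.conj_im]; linarith

end

/-- The set of states, as functions. -/
def stateSet (A : Type*) [CStarAlgebra A] : Set (A → ℂ) :=
  Set.range fun ρ : CStarState A => (ρ : A → ℂ)

theorem norm_apply_le {A : Type*} [CStarAlgebra A] (ρ : CStarState A) (x : A) :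
    ‖ρ x‖ ≤ 2 * ‖x‖ := by
  have key : ∀ y : A, (ρ y).re ≤ ‖y‖ := by
    intro y
    let _ := CStarAlgebra.spectralOrder A
    let _ := CStarAlgebra.spectralOrderedRing A
    have h := (Complex.le_def.1 (ρ.map_nonneg (sub_nonneg.2
      (IsSelfAdjoint.add_star_self y).le_algebraMap_norm_self))).1
    rw [map_sub, ρ.map_algebraMap, map_add, ρ.map_star] at h
    have h₂ := norm_add_le y (star y)
    rw [norm_star] at h₂
    simp at h
    linarith
  have h₁ := key x
  have h₂ := key (-x)
  have h₃ := key (Complex.I • x)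
  have h₄ := key (-(Complex.I • x))
  rw [norm_neg, map_neg, Complex.neg_re] at h₂ h₄
  rw [map_smul] at h₃ h₄
  simp [norm_smul] at h₃ h₄
  have h₅ : |(ρ x).re| ≤ ‖x‖ := abs_le.2 ⟨by linarith, h₁⟩
  have h₆ : |(ρ x).im| ≤ ‖x‖ := abs_le.2 ⟨by linarith, by linarith⟩
  linarith [Complex.norm_le_abs_re_add_abs_im (ρ x)]

theorem mem_stateSet {A : Type*} [CStarAlgebra A] {g : A → ℂ} :
    g ∈ stateSet A ↔ (∀ x y, g (x + y) = g x + g y) ∧ (∀ (c : ℂ) x, g (c • x) = c * g x) ∧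
      (∀ x, 0 ≤ g (star x * x)) ∧ g 1 = 1 ∧ ∀ x, ‖g x‖ ≤ 2 * ‖x‖ := by
  constructor
  · rintro ⟨ρ, rfl⟩
    exact ⟨map_add ρ, map_smul ρ, ρ.star_mul_self_nonneg, ρ.map_one, ρ.norm_apply_le⟩
  · rintro ⟨h₁, h₂, h₃, h₄, h₅⟩
    exact ⟨⟨LinearMap.mkContinuous ⟨⟨g, h₁⟩, h₂⟩ 2 h₅, h₃, h₄⟩, rfl⟩

theorem isCompact_stateSet (A : Type*) [CStarAlgebra A] : IsCompact (stateSet A) := by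
  have hsub : stateSet A ⊆ Set.pi Set.univ fun x => Metric.closedBall (0 : ℂ) (2 * ‖x‖) := by
    intro g hg x _
    simpa using (mem_stateSet.1 hg).2.2.2.2 x
  refine IsCompact.of_isClosed_subset
    (isCompact_univ_pi fun x => isCompact_closedBall (0 : ℂ) (2 * ‖x‖)) ?_ hsub
  have : stateSet A = {g | (∀ x y, g (x + y) = g x + g y) ∧ (∀ (c : ℂ) x, g (c • x) = c * g x) ∧
      (∀ x, 0 ≤ g (star x * x)) ∧ g 1 = 1 ∧ ∀ x, ‖g x‖ ≤ 2 * ‖x‖} :=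
    Set.ext fun g => mem_stateSet
  rw [this]
  refine IsClosed.and ?_ (IsClosed.and ?_ (IsClosed.and ?_ (IsClosed.and ?_ ?_)))
  · exact isClosed_forall_aux fun x => isClosed_forall_aux fun y =>
      isClosed_eq (by fun_prop) (by fun_prop)
  · exact isClosed_forall_aux fun x => isClosed_forall_aux fun y =>
      isClosed_eq (by fun_prop) (by fun_prop)
  · exact isClosed_forall_aux fun x => isClosed_le (by fun_prop) (by fun_prop)
  · exact isClosed_eq (by fun_prop) (by fun_prop)
  · exact isClosed_forall_aux fun x => isClosed_le (by fun_prop) (by fun_prop)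

theorem convex_stateSet (A : Type*) [CStarAlgebra A] : Convex ℝ (stateSet A) := by
  intro f hf g hg s t hs ht hst
  have hstc : (s : ℂ) + t = 1 := by exact_mod_cast hst
  obtain ⟨f₁, f₂, f₃, f₄, f₅⟩ := mem_stateSet.1 hf
  obtain ⟨g₁, g₂, g₃, g₄, g₅⟩ := mem_stateSet.1 hg
  refine mem_stateSet.2 ⟨fun x y => ?_, fun c x => ?_, fun x => ?_, ?_, fun x => ?_⟩ <;>
    simp only [Pi.add_apply, Pi.smul_apply, Complex.real_smul]
  · rw [f₁, g₁]; ring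
  · rw [f₂, g₂]; ring
  · exact add_nonneg (mul_nonneg (by exact_mod_cast hs) (f₃ x))
      (mul_nonneg (by exact_mod_cast ht) (g₃ x))
  · rw [f₄, g₄, mul_one, mul_one, hstc]
  · refine (norm_add_le _ _).trans ?_
    rw [norm_mul, norm_mul, Complex.norm_of_nonneg hs, Complex.norm_of_nonneg ht]
    calc s * ‖f x‖ + t * ‖g x‖ ≤ s * (2 * ‖x‖) + t * (2 * ‖x‖) := by
          gcongr
          · exact f₅ x
          · exact g₅ x
      _ = 2 * ‖x‖ := by rw [← add_mul, hst, one_mul]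

/-- Positive real-linear functionals on the real part complexify to states. -/
theorem exists_of_real {D : Type*} [CStarAlgebra D] [PartialOrder D] [StarOrderedRing D]
    (g : D →ₗ[ℝ] ℝ) (hg : ∀ x : D, 0 ≤ x + star x → 0 ≤ g x) (h1 : g 1 = 1) :
    ∃ σ : CStarState D, ∀ x, (σ x).re = g x := by
  have hskew : ∀ x : D, star x = -x → g x = 0 := by
    intro x hx
    have h₁ := hg x (by simp [hx])
    have h₂ := hg (-x) (by simp [hx])
    rw [map_neg] at h₂
    linarith
  have hle : ∀ x : D, g x ≤ ‖x‖ := by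
    intro x
    have hs : IsSelfAdjoint (x + star x) := by
      rw [IsSelfAdjoint, star_add, star_star, add_comm]
    have h := hg (algebraMap ℝ D ‖x‖ - x) (by
      have h₁ := hs.le_algebraMap_norm_self
      have h₂ : algebraMap ℝ D ‖x + star x‖ ≤ algebraMap ℝ D (‖x‖ + ‖x‖) := by
        apply algebraMap_mono
        simpa using norm_add_le x (star x)
      have h₃ := h₁.trans h₂
      rw [map_add] at h₃
      have : algebraMap ℝ D ‖x‖ - x + star (algebraMap ℝ D ‖x‖ - x) =
          algebraMap ℝ D ‖x‖ + algebraMap ℝ D ‖x‖ - (x + star x) := by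
        rw [star_sub, ← algebraMap_star_comm]
        simp only [star_trivial]
        abel
      rw [this]
      exact sub_nonneg.2 h₃)
    rw [map_sub, Algebra.algebraMap_eq_smul_one, map_smul, h1] at h
    simpa using h
  have hab : ∀ x : D, ‖g x‖ ≤ 1 * ‖x‖ := by
    intro x
    rw [one_mul, Real.norm_eq_abs, abs_le]
    refine ⟨?_, hle x⟩
    have := hle (-x)
    rw [map_neg, norm_neg] at this
    linarith
  let G : StrongDual ℝ D := g.mkContinuous 1 hab
  have hG : ∀ x, (StrongDual.extendRCLike (𝕜 := ℂ) G) x =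
      (G x : ℂ) - Complex.I * (G (Complex.I • x) : ℂ) := fun x => rfl
  refine ⟨⟨StrongDual.extendRCLike (𝕜 := ℂ) G, fun a => ?_, ?_⟩, fun x => ?_⟩
  · rw [hG]
    have h₁ : G (star a * a) = g (star a * a) := rfl
    have h₂ : G (Complex.I • (star a * a)) = 0 := hskew _ (by simp [star_smul])
    rw [h₂, h₁]
    have := hg (star a * a) (by
      have := _root_.star_mul_self_nonneg a
      simpa using add_nonneg this this)
    simpa using this
  · rw [hG]
    have h₁ : G 1 = 1 := h1
    have h₂ : G (Complex.I • (1 : D)) = 0 := hskew _ (by simp [star_smul])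
    rw [h₂, h₁]
    simp
  · exact StrongDual.re_extendRCLike_apply (𝕜 := ℂ) G x

end CStarState

/-- `ι : A ⊗ B → D` exhibits the C⋆-algebra `D` as a C⋆-tensor product of `A` and `B`, i.e. as the
completion of the algebraic tensor product (a ⋆-algebra) with respect to a C⋆-norm, namely
`t ↦ ‖ι t‖`. All C⋆-norms are allowed: the spatial one, the maximal one, and those in between. -/
structure IsCStarTensorProduct {A B D : Type*} [CStarAlgebra A] [CStarAlgebra B] [CStarAlgebra D]
    (ι : A ⊗[ℂ] B →⋆ₐ[ℂ] D) : Prop where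
  injective : Function.Injective ι
  denseRange : DenseRange ι

namespace IsCStarTensorProduct

variable {A B D : Type*} [CStarAlgebra A] [CStarAlgebra B] [CStarAlgebra D]
  {ι : A ⊗[ℂ] B →⋆ₐ[ℂ] D}

/-- If a self-adjoint `a` is not bounded below by `r`, a self-adjoint `e ≠ 0` witnesses it. -/
theorem exists_witness [PartialOrder A] [StarOrderedRing A] {a : A} (ha : IsSelfAdjoint a)
    {r : ℝ} (h : ¬ algebraMap ℝ A r ≤ a) :
    ∃ e : A, IsSelfAdjoint e ∧ e ≠ 0 ∧ 0 ≤ algebraMap ℝ A r * (e * e) - e * a * e := by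
  have hr : IsSelfAdjoint (algebraMap ℝ A r) := by
    rw [IsSelfAdjoint, ← algebraMap_star_comm, star_trivial]
  set x := a - algebraMap ℝ A r with hx
  have hxs : IsSelfAdjoint x := ha.sub hr
  have hneg : 0 ≤ x⁻ := CFC.negPart_nonneg x
  refine ⟨x⁻, hneg.isSelfAdjoint, ?_, ?_⟩
  · intro h0
    have := (CFC.negPart_eq_zero_iff x hxs).1 h0
    exact h (sub_nonneg.1 this)
  · have h₁ : a = algebraMap ℝ A r + (x⁺ - x⁻) := by
      rw [CFC.posPart_sub_negPart x hxs, hx]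
      abel
    have h₂ : x⁻ * x⁺ = 0 := CFC.negPart_mul_posPart x
    have h₃ : algebraMap ℝ A r * (x⁻ * x⁻) - x⁻ * a * x⁻ = star (x⁻) * x⁻ * x⁻ := by
      rw [hneg.isSelfAdjoint.star_eq]
      have h₄ : x⁻ * a * x⁻ = algebraMap ℝ A r * (x⁻ * x⁻) - x⁻ * x⁻ * x⁻ := by
        calc x⁻ * a * x⁻ = x⁻ * (algebraMap ℝ A r + (x⁺ - x⁻)) * x⁻ := by rw [← h₁]
          _ = _ := by
            rw [mul_add, add_mul, mul_sub, sub_mul, h₂, ← Algebra.commutes r x⁻]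
            simp [mul_assoc]
            abel
      rw [h₄]
      abel
    rw [h₃]
    exact star_left_conjugate_nonneg hneg x⁻

theorem tmul_ne_zero {a : A} {b : B} (ha : a ≠ 0) (hb : b ≠ 0) : a ⊗ₜ[ℂ] b ≠ 0 := by
  obtain ⟨f, hf⟩ := Module.Projective.exists_dual_ne_zero ℂ ha
  obtain ⟨g, hg⟩ := Module.Projective.exists_dual_ne_zero ℂ hb
  intro h
  have := congrArg (TensorProduct.lid ℂ ℂ ∘ₗ TensorProduct.map f g : A ⊗[ℂ] B →ₗ[ℂ] ℂ) h
  simp [hf, hg] at this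

theorem map_tmul_mul (x₁ x₂ : A) (y₁ y₂ : B) :
    ι (x₁ ⊗ₜ y₁) * ι (x₂ ⊗ₜ y₂) = ι ((x₁ * x₂) ⊗ₜ (y₁ * y₂)) := by
  rw [← map_mul, Algebra.TensorProduct.tmul_mul_tmul]

theorem map_tmul_star_mul_self_nonneg [PartialOrder A] [StarOrderedRing A] [PartialOrder B]
    [StarOrderedRing B] [PartialOrder D] [StarOrderedRing D] {x : A} {y : B} (hx : 0 ≤ x)
    (hy : 0 ≤ y) : 0 ≤ ι (x ⊗ₜ y) := by
  obtain ⟨c, rfl⟩ := CStarAlgebra.nonneg_iff_eq_star_mul_self.1 hx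
  obtain ⟨d, rfl⟩ := CStarAlgebra.nonneg_iff_eq_star_mul_self.1 hy
  rw [← map_tmul_mul, ← TensorProduct.star_tmul, map_star]
  exact star_mul_self_nonneg _

/-- The functional `a ⊗ 1 + 1 ⊗ b ↦ ρ a + τ b` is positive. -/
theorem joint_nonneg [PartialOrder A] [StarOrderedRing A] [PartialOrder B]
    [StarOrderedRing B] [PartialOrder D] [StarOrderedRing D] (hι : IsCStarTensorProduct ι)
    (ρ : CStarState A) (τ : CStarState B) {a : A} {b : B} (ha : IsSelfAdjoint a)
    (hb : IsSelfAdjoint b) (h : 0 ≤ ι (a ⊗ₜ 1 + 1 ⊗ₜ b)) : 0 ≤ (ρ a).re + (τ b).re := by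
  by_contra! hlt
  set d : ℝ := -((ρ a).re + (τ b).re) / 4 with hd
  have hd0 : 0 < d := by rw [hd]; linarith
  set r : ℝ := (ρ a).re + d with hr
  set s : ℝ := (τ b).re + d with hs
  have hrs : r + s < 0 := by rw [hr, hs]; linarith
  have hra : ¬ algebraMap ℝ A r ≤ a := by
    intro hle
    have := (Complex.le_def.1 (ρ.map_nonneg (sub_nonneg.2 hle))).1
    rw [map_sub, ρ.map_algebraMap] at this
    simp at this
    linarith
  have hsb : ¬ algebraMap ℝ B s ≤ b := by
    intro hle
    have := (Complex.le_def.1 (τ.map_nonneg (sub_nonneg.2 hle))).1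
    rw [map_sub, τ.map_algebraMap] at this
    simp at this
    linarith
  obtain ⟨e, he, he0, hea⟩ := exists_witness ha hra
  obtain ⟨f, hf, hf0, hfb⟩ := exists_witness hb hsb
  have hee : 0 ≤ e * e := by simpa [he.star_eq] using star_mul_self_nonneg e
  have hff : 0 ≤ f * f := by simpa [hf.star_eq] using star_mul_self_nonneg f
  have h₁ := map_tmul_star_mul_self_nonneg (ι := ι) hea hff
  have h₂ := map_tmul_star_mul_self_nonneg (ι := ι) hee hfb
  have h₃ := star_left_conjugate_nonneg h (ι (e ⊗ₜ f))
  have h₅ := map_tmul_star_mul_self_nonneg (ι := ι) hee hff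
  rw [← map_star, TensorProduct.star_tmul, he.star_eq, hf.star_eq, map_add, mul_add, add_mul,
    map_tmul_mul, map_tmul_mul, map_tmul_mul, map_tmul_mul, mul_one, mul_one] at h₃
  have hAr : algebraMap ℝ A r * (e * e) = (r : ℂ) • (e * e) := by
    rw [IsScalarTower.algebraMap_apply ℝ ℂ A, ← Algebra.smul_def]; rfl
  have hBs : algebraMap ℝ B s * (f * f) = (s : ℂ) • (f * f) := by
    rw [IsScalarTower.algebraMap_apply ℝ ℂ B, ← Algebra.smul_def]; rfl
  rw [hAr, TensorProduct.sub_tmul, ← TensorProduct.smul_tmul', map_sub, map_smul] at h₁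
  rw [hBs, TensorProduct.tmul_sub, TensorProduct.tmul_smul, map_sub, map_smul] at h₂
  have h₄ := add_nonneg (add_nonneg h₁ h₂) h₃
  set z := ι ((e * e) ⊗ₜ (f * f)) with hz
  have h₆ : 0 ≤ (r + s) • z := by
    convert! h₄ using 1
    rw [add_smul, ← Complex.coe_smul, ← Complex.coe_smul]
    abel
  have h₇ : 0 ≤ (-(r + s)) • z := smul_nonneg (by linarith) h₅
  have h₈ : (r + s) • z = 0 := le_antisymm (by rwa [neg_smul, neg_nonneg] at h₇) h₆
  have h₉ : z = 0 := (smul_eq_zero.1 h₈).resolve_left hrs.ne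
  have h₁₀ : (e * e) ⊗ₜ[ℂ] (f * f) = 0 := hι.injective (by rw [map_zero]; exact h₉)
  refine tmul_ne_zero (A := A) (B := B) ?_ ?_ h₁₀
  · intro h0
    apply he0
    rw [← CStarRing.star_mul_self_eq_zero_iff, he.star_eq, h0]
  · intro h0
    apply hf0
    rw [← CStarRing.star_mul_self_eq_zero_iff, hf.star_eq, h0]

/-- Any two states on the factors have a common extension to the tensor product. -/
theorem exists_joint (hι : IsCStarTensorProduct ι) (ρ : CStarState A) (τ : CStarState B) :
    ∃ σ : CStarState D, (∀ a, σ (ι (a ⊗ₜ 1)) = ρ a) ∧ ∀ b, σ (ι (1 ⊗ₜ b)) = τ b := by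
  let _ := CStarAlgebra.spectralOrder A
  let _ := CStarAlgebra.spectralOrderedRing A
  let _ := CStarAlgebra.spectralOrder B
  let _ := CStarAlgebra.spectralOrderedRing B
  let _ := CStarAlgebra.spectralOrder D
  let _ := CStarAlgebra.spectralOrderedRing D
  let L : (A × B) →ₗ[ℝ] D :=
    { toFun := fun x => ι (x.1 ⊗ₜ 1 + 1 ⊗ₜ x.2)
      map_add' := fun x y => by
        rw [← map_add]
        simp only [Prod.fst_add, Prod.snd_add, TensorProduct.add_tmul, TensorProduct.tmul_add]
        congr 1
        abel
      map_smul' := fun c x => by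
        simp only [Prod.smul_fst, Prod.smul_snd, RingHom.id_apply, map_add, smul_add]
        rw [← Complex.coe_smul c x.1, ← Complex.coe_smul c x.2, ← TensorProduct.smul_tmul',
          TensorProduct.tmul_smul, map_smul, map_smul, Complex.coe_smul, Complex.coe_smul] }
  let p : (A × B) →ₗ[ℝ] ℝ :=
    { toFun := fun x => (ρ x.1).re + (τ x.2).re
      map_add' := fun x y => by
        simp only [Prod.fst_add, Prod.snd_add, map_add, Complex.add_re]
        ring
      map_smul' := fun c x => by
        simp only [Prod.smul_fst, Prod.smul_snd, RingHom.id_apply]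
        rw [← Complex.coe_smul c x.1, ← Complex.coe_smul c x.2, map_smul, map_smul]
        simp [mul_add] }
  have hLp : ∀ x, 0 ≤ L x + star (L x) → 0 ≤ p x := by
    rintro ⟨a, b⟩ h
    have h' : L (a, b) + star (L (a, b)) = ι ((a + star a) ⊗ₜ 1 + 1 ⊗ₜ (b + star b)) := by
      change ι (a ⊗ₜ 1 + 1 ⊗ₜ b) + star (ι (a ⊗ₜ 1 + 1 ⊗ₜ b)) = _
      rw [← map_star, ← map_add]
      simp only [star_add, TensorProduct.star_tmul, star_one, TensorProduct.add_tmul,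
        TensorProduct.tmul_add]
      congr 1
      abel
    rw [h'] at h
    have := hι.joint_nonneg ρ τ (IsSelfAdjoint.add_star_self a) (IsSelfAdjoint.add_star_self b) h
    simp only [map_add, ρ.map_star, τ.map_star, Complex.add_re, Complex.conj_re] at this
    change 0 ≤ (ρ a).re + (τ b).re
    linarith
  have hker : p ∈ LinearMap.range L.dualMap := by
    rw [LinearMap.range_dualMap_eq_dualAnnihilator_ker, Submodule.mem_dualAnnihilator]
    intro x hx
    have hx' : L x = 0 := hx
    have h₁ := hLp x (by simp [hx'])
    have h₂ := hLp (-x) (by simp [hx'])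
    rw [map_neg] at h₂
    linarith
  obtain ⟨f, hf⟩ := hker
  have hfL : ∀ x, f (L x) = p x := fun x => LinearMap.congr_fun hf x
  let s : PointedCone ℝ D :=
    { carrier := {x | 0 ≤ x + star x}
      add_mem' := fun {x y} hx hy => by
        have hx' : 0 ≤ x + star x := hx
        have hy' : 0 ≤ y + star y := hy
        change 0 ≤ x + y + star (x + y)
        have := add_nonneg hx' hy'
        rw [star_add]
        convert! this using 1
        abel
      zero_mem' := by
        change 0 ≤ (0 : D) + star 0
        simp
      smul_mem' := fun c x hx => by
        have hx' : 0 ≤ x + star x := hx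
        change 0 ≤ (c : ℝ) • x + star ((c : ℝ) • x)
        have : 0 ≤ (c : ℝ) • (x + star x) := smul_nonneg c.2 hx'
        rwa [star_smul, star_trivial, ← smul_add] }
  obtain ⟨g, hg, hgs⟩ := riesz_extension s (f.toPMap (LinearMap.range L))
    (by
      rintro ⟨_, x, rfl⟩ hx
      exact (hLp x hx).trans_eq (hfL x).symm)
    (by
      intro y
      refine ⟨⟨L ((‖y + star y‖ / 2) • 1, 0), _, rfl⟩, ?_⟩
      have h₁ := (IsSelfAdjoint.add_star_self y).neg_algebraMap_norm_le_self
      have h₂ : L ((‖y + star y‖ / 2) • 1, 0) = (‖y + star y‖ / 2) • 1 := by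
        have h₃ : L (1, 0) = 1 := by
          change ι (1 ⊗ₜ 1 + 1 ⊗ₜ 0) = 1
          rw [TensorProduct.tmul_zero, add_zero]
          exact map_one ι
        rw [← h₃, ← map_smul]
        simp
      change 0 ≤ L ((‖y + star y‖ / 2) • 1, 0) + y + star (L ((‖y + star y‖ / 2) • 1, 0) + y)
      rw [h₂, star_add, star_smul, star_one, star_trivial (‖y + star y‖ / 2)]
      have h₄ : (‖y + star y‖ / 2) • (1 : D) + y + ((‖y + star y‖ / 2) • 1 + star y) =
          algebraMap ℝ D ‖y + star y‖ + (y + star y) := by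
        rw [Algebra.algebraMap_eq_smul_one]
        nth_rewrite 3 [← add_halves ‖y + star y‖]
        rw [add_smul]
        abel
      rw [h₄]
      exact neg_le_iff_add_nonneg'.1 h₁)
  have hgL : ∀ x, g (L x) = p x := fun x => (hg ⟨L x, x, rfl⟩).trans (hfL x)
  obtain ⟨σ, hσ⟩ := CStarState.exists_of_real g hgs (by
    have := hgL (1, 0)
    have h₁ : L (1, 0) = 1 := by
      change ι (1 ⊗ₜ 1 + 1 ⊗ₜ 0) = 1
      rw [TensorProduct.tmul_zero, add_zero]
      exact map_one ι
    rw [h₁] at this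
    rw [this]
    change (ρ 1).re + (τ 0).re = 1
    simp)
  have hA : ∀ a, (σ (ι (a ⊗ₜ 1))).re = (ρ a).re := fun a => by
    rw [hσ]
    have := hgL (a, 0)
    change g (ι (a ⊗ₜ 1 + 1 ⊗ₜ 0)) = (ρ a).re + (τ 0).re at this
    simpa using this
  have hB : ∀ b, (σ (ι (1 ⊗ₜ b))).re = (τ b).re := fun b => by
    rw [hσ]
    have := hgL (0, b)
    change g (ι (0 ⊗ₜ 1 + 1 ⊗ₜ b)) = (ρ 0).re + (τ b).re at this
    simpa using this
  refine ⟨σ, fun a => Complex.ext (hA a) ?_, fun b => Complex.ext (hB b) ?_⟩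
  · have := hA (Complex.I • a)
    rw [← TensorProduct.smul_tmul', map_smul, map_smul, map_smul] at this
    simpa using this
  · have := hB (Complex.I • b)
    rw [TensorProduct.tmul_smul, map_smul, map_smul, map_smul] at this
    simpa using this

/-- The second factor embedded into the tensor product, `b ↦ 1 ⊗ b`. -/
def inr (ι : A ⊗[ℂ] B →⋆ₐ[ℂ] D) : B →⋆ₐ[ℂ] D where
  toAlgHom := ι.toAlgHom.comp Algebra.TensorProduct.includeRight
  map_star' b := by
    change ι (1 ⊗ₜ star b) = star (ι (1 ⊗ₜ b))
    rw [← map_star, TensorProduct.star_tmul, star_one]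

theorem inr_apply (b : B) : inr ι b = ι (1 ⊗ₜ b) := rfl

/-- A state whose restriction to the second factor is pure factorizes. -/
theorem map_tmul_of_extreme {τ : B → ℂ}
    (hτ : τ ∈ Set.extremePoints ℝ (CStarState.stateSet B)) (σ : CStarState D)
    (hσ : ∀ b, σ (ι (1 ⊗ₜ b)) = τ b) (a : A) (b : B) :
    σ (ι (a ⊗ₜ b)) = σ (ι (a ⊗ₜ 1)) * τ b := by
  let _ := CStarAlgebra.spectralOrder A
  let _ := CStarAlgebra.spectralOrderedRing A
  have hone : σ (ι (1 ⊗ₜ 1)) = 1 := by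
    have : ι (1 ⊗ₜ 1) = 1 := map_one ι
    rw [this, σ.map_one]
  have key : ∀ c d : A, star c * c + star d * d = 1 → σ (ι ((star c * c) ⊗ₜ 1)) ≠ 0 →
      σ (ι ((star d * d) ⊗ₜ 1)) ≠ 0 → ∀ b, σ (ι ((star c * c) ⊗ₜ b)) =
        σ (ι ((star c * c) ⊗ₜ 1)) * τ b := by
    intro c d hcd hc hd
    have hconj : ∀ (e : A) (b : B), star (ι (e ⊗ₜ 1)) * inr ι b * ι (e ⊗ₜ 1) =
        ι ((star e * e) ⊗ₜ b) := by
      intro e b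
      rw [inr_apply, ← map_star, TensorProduct.star_tmul, star_one, map_tmul_mul, map_tmul_mul]
      simp
    have hsq : ∀ e : A, star (ι (e ⊗ₜ 1)) * ι (e ⊗ₜ 1) = ι ((star e * e) ⊗ₜ (1 : B)) := by
      intro e
      rw [← map_star, TensorProduct.star_tmul, star_one, map_tmul_mul, mul_one]
    have hc' : σ (star (ι (c ⊗ₜ 1)) * ι (c ⊗ₜ 1)) ≠ 0 := by rwa [hsq]
    have hd' : σ (star (ι (d ⊗ₜ 1)) * ι (d ⊗ₜ 1)) ≠ 0 := by rwa [hsq]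
    set τc := CStarState.comap (inr ι) (σ.reduced _ hc')
    set τd := CStarState.comap (inr ι) (σ.reduced _ hd')
    have hτc : ∀ b, τc b = σ (ι ((star c * c) ⊗ₜ b)) / σ (ι ((star c * c) ⊗ₜ 1)) := fun b => by
      rw [CStarState.comap_apply, CStarState.reduced_apply, hconj, hsq]
    have hτd : ∀ b, τd b = σ (ι ((star d * d) ⊗ₜ b)) / σ (ι ((star d * d) ⊗ₜ 1)) := fun b => by
      rw [CStarState.comap_apply, CStarState.reduced_apply, hconj, hsq]
    have hpos : ∀ e : A, 0 ≤ σ (ι ((star e * e) ⊗ₜ 1)) := fun e => by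
      rw [← hsq]
      exact σ.star_mul_self_nonneg _
    have hreal : ∀ e : A, (((σ (ι ((star e * e) ⊗ₜ 1))).re : ℝ) : ℂ) =
        σ (ι ((star e * e) ⊗ₜ 1)) := fun e =>
      Complex.ext rfl (by simpa using (Complex.le_def.1 (hpos e)).2)
    have hre : ∀ e : A, σ (ι ((star e * e) ⊗ₜ 1)) ≠ 0 →
        0 < (σ (ι ((star e * e) ⊗ₜ 1))).re := fun e he =>
      lt_of_le_of_ne (Complex.le_def.1 (hpos e)).1 (fun h0 => he (by rw [← hreal e, ← h0]; simp))
    have hsum : ∀ b, σ (ι ((star c * c) ⊗ₜ b)) + σ (ι ((star d * d) ⊗ₜ b)) = τ b := by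
      intro b
      rw [← map_add, ← map_add, ← TensorProduct.add_tmul, hcd, hσ]
    have hmem := (mem_extremePoints.1 hτ).2 τc ⟨τc, rfl⟩ τd ⟨τd, rfl⟩
      ⟨_, _, hre c hc, hre d hd, by
        have h := hsum 1
        rw [← hσ, hone] at h
        have := congrArg Complex.re h
        simpa using this, by
        funext b
        simp only [Pi.add_apply, Pi.smul_apply, Complex.real_smul]
        rw [hreal, hreal, hτc, hτd, mul_div_cancel₀ _ hc, mul_div_cancel₀ _ hd, hsum]⟩
    intro b
    rw [← hmem.1, hτc, mul_div_cancel₀ _ hc]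
  have hx : ∀ x : A, 0 ≤ x → x ≤ 1 → σ (ι (x ⊗ₜ b)) = σ (ι (x ⊗ₜ 1)) * τ b := by
    intro x hx0 hx1
    have h₁ : 0 ≤ (3⁻¹ : ℝ) • (1 + x) := smul_nonneg (by norm_num) (add_nonneg zero_le_one hx0)
    have h₂ : 0 ≤ (3⁻¹ : ℝ) • (1 + (1 - x)) :=
      smul_nonneg (by norm_num) (add_nonneg zero_le_one (sub_nonneg.2 hx1))
    obtain ⟨c, hc⟩ := CStarAlgebra.nonneg_iff_eq_star_mul_self.1 h₁
    obtain ⟨d, hd⟩ := CStarAlgebra.nonneg_iff_eq_star_mul_self.1 h₂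
    have hnn : ∀ y : A, 0 ≤ y → 0 ≤ σ (ι (y ⊗ₜ 1)) := by
      intro y hy
      obtain ⟨e, rfl⟩ := CStarAlgebra.nonneg_iff_eq_star_mul_self.1 hy
      have : ι ((star e * e) ⊗ₜ (1 : B)) = star (ι (e ⊗ₜ 1)) * ι (e ⊗ₜ 1) := by
        rw [← map_star, TensorProduct.star_tmul, star_one, map_tmul_mul, mul_one]
      rw [this]
      exact σ.star_mul_self_nonneg _
    have hlin : ∀ (y : A) (b : B), σ (ι (((3⁻¹ : ℝ) • (1 + y)) ⊗ₜ b)) =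
        3⁻¹ * (τ b + σ (ι (y ⊗ₜ b))) := by
      intro y b
      rw [← Complex.coe_smul, ← TensorProduct.smul_tmul', map_smul, map_smul,
        TensorProduct.add_tmul, map_add, map_add, hσ]
      simp
    have hτ1 : τ 1 = 1 := by rw [← hσ, hone]
    have hne : ∀ y : A, 0 ≤ y → σ (ι (((3⁻¹ : ℝ) • (1 + y)) ⊗ₜ 1)) ≠ 0 := by
      intro y hy h0
      rw [hlin, hτ1] at h0
      have h3 := (Complex.le_def.1 (hnn y hy)).1
      have h4 : 1 + σ (ι (y ⊗ₜ 1)) = 0 := by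
        simpa using h0
      have h5 := congrArg Complex.re h4
      simp at h5 h3
      linarith
    have h := key c d (by
      rw [← hc, ← hd, ← smul_add]
      have : (1 : A) + x + (1 + (1 - x)) = (3 : ℝ) • 1 := by
        rw [show (3 : ℝ) = 1 + 1 + 1 by norm_num, add_smul, add_smul, one_smul]
        abel
      rw [this, smul_smul]
      norm_num) (by rw [← hc]; exact hne x hx0)
      (by rw [← hd]; exact hne _ (sub_nonneg.2 hx1)) b
    rw [← hc, hlin, hlin, hτ1, mul_assoc, mul_right_inj' (by norm_num), add_mul, one_mul] at h
    exact add_left_cancel h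
  have hspan : a ∈ Submodule.span ℂ ({x : A | 0 ≤ x} ∩ Metric.ball 0 1) := by
    rw [CStarAlgebra.span_nonneg_inter_unitBall]
    trivial
  induction hspan using Submodule.span_induction with
  | mem x h =>
    refine hx x h.1 ((CStarAlgebra.norm_le_one_iff_of_nonneg x h.1).1 ?_)
    exact (mem_ball_zero_iff.1 h.2).le
  | zero => simp
  | add x y _ _ h₁ h₂ =>
    rw [TensorProduct.add_tmul, TensorProduct.add_tmul, map_add, map_add, map_add, map_add, h₁, h₂,
      add_mul]
  | smul c x _ h =>
    rw [← TensorProduct.smul_tmul', ← TensorProduct.smul_tmul', map_smul, map_smul, map_smul,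
      map_smul, h, smul_eq_mul, smul_eq_mul, mul_assoc]

/-- Existence of product states on any C⋆-tensor product. -/
theorem exists_product (hι : IsCStarTensorProduct ι) (ρ : CStarState A) (τ : CStarState B) :
    ∃ σ : CStarState D, ∀ a b, σ (ι (a ⊗ₜ b)) = ρ a * τ b := by
  let K : Set (D → ℂ) := CStarState.stateSet D ∩
    {g | ∀ a b, g (ι (a ⊗ₜ b)) = ρ a * g (ι (1 ⊗ₜ b))}
  have hKc : IsCompact K := by
    refine (CStarState.isCompact_stateSet D).inter_right ?_
    exact isClosed_forall_aux fun x => isClosed_forall_aux fun y =>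
      isClosed_eq (by fun_prop) (by fun_prop)
  have hKconv : Convex ℝ K := by
    refine (CStarState.convex_stateSet D).inter ?_
    intro f hf g hg s t _ _ _ a b
    simp only [Pi.add_apply, Pi.smul_apply, Complex.real_smul]
    rw [hf a b, hg a b]
    ring
  let R : (D → ℂ) →ₗ[ℝ] (B → ℂ) :=
    { toFun := fun g b => g (ι (1 ⊗ₜ b))
      map_add' := fun _ _ => rfl
      map_smul' := fun _ _ => rfl }
  have hR : Continuous R := continuous_pi fun b => continuous_apply (ι (1 ⊗ₜ b))
  have hE : IsClosed (R '' K) := (hKc.image hR).isClosed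
  have hEconv : Convex ℝ (R '' K) := hKconv.linear_image R
  have hext : Set.extremePoints ℝ (CStarState.stateSet B) ⊆ R '' K := by
    intro f hf
    obtain ⟨τ', rfl⟩ := (mem_extremePoints.1 hf).1
    obtain ⟨σ, h₁, h₂⟩ := hι.exists_joint ρ τ'
    refine ⟨σ, ⟨⟨σ, rfl⟩, fun a b => ?_⟩, funext h₂⟩
    rw [map_tmul_of_extreme hf σ h₂, h₁, h₂]
  have hτ : (τ : B → ℂ) ∈ R '' K := by
    have h : (τ : B → ℂ) ∈ CStarState.stateSet B := ⟨τ, rfl⟩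
    rw [← closure_convexHull_extremePoints (CStarState.isCompact_stateSet B)
      (CStarState.convex_stateSet B)] at h
    exact closure_minimal (convexHull_min hext hEconv) hE h
  obtain ⟨g, ⟨⟨σ, rfl⟩, h₁⟩, h₂⟩ := hτ
  refine ⟨σ, fun a b => ?_⟩
  refine (h₁ a b).trans ?_
  congr 1
  exact congrFun h₂ b

/-- The product state `ρ ⊗ τ`: the state on the tensor product with
`(ρ ⊗ τ)(a ⊗ b) = ρ(a) τ(b)` for all `a` and `b`; it exists and is unique. -/
noncomputable def productState (hι : IsCStarTensorProduct ι) (ρ : CStarState A)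
    (τ : CStarState B) : CStarState D :=
  (hι.exists_product ρ τ).choose

theorem productState_tmul (hι : IsCStarTensorProduct ι) (ρ : CStarState A) (τ : CStarState B)
    (a : A) (b : B) : hι.productState ρ τ (ι (a ⊗ₜ b)) = ρ a * τ b :=
  (hι.exists_product ρ τ).choose_spec a b

theorem eq_productState (hι : IsCStarTensorProduct ι) (ρ : CStarState A) (τ : CStarState B)
    (σ : CStarState D) (h : ∀ a b, σ (ι (a ⊗ₜ b)) = ρ a * τ b) : σ = hι.productState ρ τ := by
  apply DFunLike.coe_injective
  refine hι.denseRange.equalizer (map_continuous σ) (map_continuous (hι.productState ρ τ)) ?_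
  funext t
  simp only [Function.comp_apply]
  induction t with
  | zero => simp
  | tmul a b => rw [h, productState_tmul]
  | add x y hx hy => rw [map_add, map_add, map_add, hx, hy]

/-- The measurement operation `M^*(ρ) = α^*(ρ ⊗ τ) = (ρ ⊗ τ) ∘ α` on states, for an automorphism
`α` of the tensor product and a fixed state `τ` of the second factor. -/
noncomputable def measurement (hι : IsCStarTensorProduct ι) (α : D ≃⋆ₐ[ℂ] D) (τ : CStarState B)
    (ρ : CStarState A) : CStarState D :=
  CStarState.comap (α : D →⋆ₐ[ℂ] D) (hι.productState ρ τ)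

theorem measurement_apply (hι : IsCStarTensorProduct ι) (α : D ≃⋆ₐ[ℂ] D) (τ : CStarState B)
    (ρ : CStarState A) (x : D) : hι.measurement α τ ρ x = hι.productState ρ τ (α x) := rfl

end IsCStarTensorProduct

/-!
# Reduced states under an approximate measurement

Let `ω = ρ ⊗ τ`, `p = P ⊗ 1` and `q = α Q`. Composing with `α` is isometric, and `ρ_P ⊗ τ` is the
reduced state `ω_p` (`productState_reduced`), so the claim is a comparison of `ω_q` with `ω_p` for
two projections of the tensor product.

In the GNS space of `ω`, with `x Ω` the vector of `x`, one has
`ω (q x q) - ω (p x p) = ⟪(q - p) Ω, x q Ω⟫ + ⟪p Ω, x (q - p) Ω⟫`, and hence two projections whose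
vectors are close have close reduced states (`norm_reduced_apply_sub_le`). The vectors are close
because of the identity `(q - p)² = (p - p q p) + (1 - p) q (1 - p)`: the hypothesis, applied to the
states `ρ_P` and `ρ_{1 - P}`, on which `P` takes the values `1` and `0`, bounds `ω` of the two
summands by `Δ ρ(P)` and `Δ ρ(1 - P)`, so that `‖(q - p) Ω‖² ≤ Δ`. The resulting estimate has
`2 + √Δ` in place of the larger `1 + 2 √Δ + √(1 + (1 + 2 √Δ)²)`.
-/

namespace CStarState

universe u

section

variable {D : Type u} [CStarAlgebra D]

/-- The GNS representation of a state, before separation and completion: a semi-inner product space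
`H` and a linear map `v`, to be thought of as `a ↦ a Ω`, with `⟪v a, v b⟫ = ω (a⋆ b)`, on which `D`
acts contractively from the left. -/
theorem exists_gns (ω : CStarState D) :
    ∃ (H : Type u) (_ : SeminormedAddCommGroup H) (_ : InnerProductSpace ℂ H) (v : D →ₗ[ℂ] H),
      (∀ a b, inner ℂ (v a) (v b) = ω (star a * b)) ∧ ∀ a b, ‖v (a * b)‖ ≤ ‖a‖ * ‖v b‖ := by
  let _ := CStarAlgebra.spectralOrder D
  let _ := CStarAlgebra.spectralOrderedRing D
  let f : D →ₚ[ℂ] ℂ := PositiveLinearMap.mk₀ ω.toDual.toLinearMap fun x hx => ω.map_nonneg hx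
  refine ⟨f.PreGNS, inferInstance, inferInstance, f.toPreGNS.toLinearMap, fun a b => rfl,
    fun a b => ?_⟩
  exact ((f.leftMulMapPreGNS a).le_opNorm (f.toPreGNS b)).trans
    (mul_le_mul_of_nonneg_right (LinearMap.mkContinuous_norm_le _ (norm_nonneg a) _)
      (norm_nonneg _))

theorem ofReal_re_star_mul_self (ω : CStarState D) (a : D) :
    (((ω (star a * a)).re : ℝ) : ℂ) = ω (star a * a) :=
  Complex.ext rfl (by simpa using (Complex.le_def.1 (ω.star_mul_self_nonneg a)).2)

theorem re_star_mul_self_nonneg (ω : CStarState D) (a : D) : 0 ≤ (ω (star a * a)).re :=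
  (Complex.le_def.1 (ω.star_mul_self_nonneg a)).1

theorem norm_conjugate_le (ω : CStarState D) (y x : D) :
    ‖ω (star y * x * y)‖ ≤ ‖x‖ * (ω (star y * y)).re := by
  obtain ⟨H, _, _, v, hv, hmul⟩ := ω.exists_gns
  have hy : ‖v y‖ ^ 2 = (ω (star y * y)).re := by
    rw [← hv, ← inner_self_eq_norm_sq (𝕜 := ℂ)]; rfl
  rw [mul_assoc, ← hv, ← hy]
  calc _ ≤ ‖v y‖ * ‖v (x * y)‖ := norm_inner_le_norm _ _
    _ ≤ ‖v y‖ * (‖x‖ * ‖v y‖) := by gcongr; exact hmul x y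
    _ = _ := by ring

theorem re_le_one_of_isStarProjection (ω : CStarState D) {p : D} (hp : IsStarProjection p) :
    (ω p).re ≤ 1 := by
  have h := ω.re_star_mul_self_nonneg (1 - p)
  rw [hp.one_sub.isSelfAdjoint.star_eq, hp.one_sub.isIdempotentElem.eq, map_sub, map_one] at h
  simpa using h

/-- Comparison of `⟪y Ω, x y Ω⟫` with `⟪z Ω, x z Ω⟫` in the GNS space: the square roots are the norms
of `(y - z) Ω`, `y Ω` and `z Ω`. -/
theorem norm_conjugate_sub_conjugate_le (ω : CStarState D) (y z x : D) :
    ‖ω (star y * x * y) - ω (star z * x * z)‖ ≤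
      √(ω (star (y - z) * (y - z))).re *
        (√(ω (star y * y)).re + √(ω (star z * z)).re) * ‖x‖ := by
  obtain ⟨H, _, _, v, hv, hmul⟩ := ω.exists_gns
  have hn : ∀ a, √(ω (star a * a)).re = ‖v a‖ := fun a => by
    rw [← hv, norm_eq_sqrt_re_inner (𝕜 := ℂ)]; rfl
  have hsplit : ω (star y * x * y) - ω (star z * x * z) =
      inner ℂ (v (y - z)) (v (x * y)) + inner ℂ (v z) (v (x * (y - z))) := by
    rw [hv, hv, ← map_sub, ← map_add]
    congr 1
    rw [star_sub]
    noncomm_ring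
  rw [hn, hn, hn, hsplit]
  calc _ ≤ ‖v (y - z)‖ * ‖v (x * y)‖ + ‖v z‖ * ‖v (x * (y - z))‖ :=
        (norm_add_le _ _).trans (add_le_add (norm_inner_le_norm _ _) (norm_inner_le_norm _ _))
    _ ≤ ‖v (y - z)‖ * (‖x‖ * ‖v y‖) + ‖v z‖ * (‖x‖ * ‖v (y - z)‖) := by
        gcongr
        · exact hmul x y
        · exact hmul x (y - z)
    _ = _ := by ring

/-- Two projections that are close in the GNS seminorm of `ω` and have close probabilities give
close reduced states. -/
theorem norm_reduced_apply_sub_le (ω : CStarState D) {p q : D} (hp : IsStarProjection p)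
    (hq : IsStarProjection q) (hωp : ω (star p * p) ≠ 0) (hωq : ω (star q * q) ≠ 0) {Δ : ℝ}
    (hΔ : 0 ≤ Δ) (hpq : (ω (star (q - p) * (q - p))).re ≤ Δ) (h : ‖ω q - ω p‖ ≤ Δ) (x : D) :
    ‖ω.reduced q hωq x - ω.reduced p hωp x‖ ≤ √Δ / (ω q).re * (2 + √Δ) * ‖x‖ := by
  have hpp : star p * p = p := by rw [hp.isSelfAdjoint.star_eq, hp.isIdempotentElem.eq]
  have hqq : star q * q = q := by rw [hq.isSelfAdjoint.star_eq, hq.isIdempotentElem.eq]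
  have hN := ω.norm_conjugate_sub_conjugate_le q p x
  have hNp := ω.norm_conjugate_le p x
  have hsp := ω.ofReal_re_star_mul_self p
  have hsq := ω.ofReal_re_star_mul_self q
  have hp0 := ω.re_star_mul_self_nonneg p
  have hq0 := ω.re_star_mul_self_nonneg q
  have hp1 := Real.sqrt_le_one.2 (ω.re_le_one_of_isStarProjection hp)
  have hq1 := Real.sqrt_le_one.2 (ω.re_le_one_of_isStarProjection hq)
  rw [reduced_apply, reduced_apply]
  simp only [hpp, hqq] at *
  set s := (ω q).re
  set t := (ω p).re
  set M := ω (star q * x * q)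
  set N := ω (star p * x * p)
  rw [← hsp] at hωp h
  rw [← hsq] at hωq h
  rw [← hsp, ← hsq]
  have hs : 0 < s := lt_of_le_of_ne hq0 fun h0 => hωq (by rw [← h0]; simp)
  have ht : 0 < t := lt_of_le_of_ne hp0 fun h0 => hωp (by rw [← h0]; simp)
  have hMN : ‖M - N‖ ≤ 2 * √Δ * ‖x‖ := hN.trans (by
    have h₁ := Real.sqrt_le_sqrt hpq
    calc _ ≤ √Δ * (1 + 1) * ‖x‖ := by gcongr
      _ = _ := by ring)
  have hsplit : M / (s : ℂ) - N / (t : ℂ) =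
      (M - N) / (s : ℂ) - N / (t : ℂ) * (((s : ℂ) - t) / (s : ℂ)) := by
    field_simp
    ring
  have hnt : ‖N / (t : ℂ)‖ ≤ ‖x‖ := by
    rw [norm_div, Complex.norm_of_nonneg ht.le, div_le_iff₀ ht]
    exact hNp
  rw [hsplit]
  calc _ ≤ ‖(M - N) / (s : ℂ)‖ + ‖N / (t : ℂ) * (((s : ℂ) - t) / (s : ℂ))‖ := norm_sub_le _ _
    _ ≤ 2 * √Δ * ‖x‖ / s + ‖x‖ * (Δ / s) := by
        rw [norm_mul, norm_div (M - N), norm_div ((s : ℂ) - t), Complex.norm_of_nonneg hs.le]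
        gcongr
    _ = √Δ / s * (2 + √Δ) * ‖x‖ := by
        nth_rewrite 2 [← Real.mul_self_sqrt hΔ]
        ring

theorem reduced_apply_self (ω : CStarState D) {p : D} (hp : IsStarProjection p)
    (h : ω (star p * p) ≠ 0) : ω.reduced p h p = 1 := by
  rw [reduced_apply, mul_assoc, hp.isIdempotentElem.eq, div_self h]

theorem reduced_one_sub_apply (ω : CStarState D) {p : D} (hp : IsStarProjection p)
    (h : ω (star (1 - p) * (1 - p)) ≠ 0) : ω.reduced (1 - p) h p = 0 := by
  rw [reduced_apply, mul_assoc, hp.isIdempotentElem.mul_one_sub_self, mul_zero, map_zero, zero_div]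

end

end CStarState

namespace IsCStarTensorProduct

variable {A B D : Type*} [CStarAlgebra A] [CStarAlgebra B] [CStarAlgebra D]
  {ι : A ⊗[ℂ] B →⋆ₐ[ℂ] D}

theorem star_map_tmul_one_mul_self (Y : A) :
    star (ι (Y ⊗ₜ 1)) * ι (Y ⊗ₜ 1) = ι ((star Y * Y) ⊗ₜ (1 : B)) := by
  rw [← map_star, TensorProduct.star_tmul, star_one, map_tmul_mul, mul_one]

theorem productState_tmul_one (hι : IsCStarTensorProduct ι) (ρ : CStarState A) (τ : CStarState B)
    (a : A) : hι.productState ρ τ (ι (a ⊗ₜ 1)) = ρ a := by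
  rw [productState_tmul, CStarState.map_one, mul_one]

theorem productState_star_mul_self (hι : IsCStarTensorProduct ι) (ρ : CStarState A)
    (τ : CStarState B) (Y : A) :
    hι.productState ρ τ (star (ι (Y ⊗ₜ 1)) * ι (Y ⊗ₜ 1)) = ρ (star Y * Y) := by
  rw [star_map_tmul_one_mul_self, productState_tmul_one]

theorem productState_reduced (hι : IsCStarTensorProduct ι) (ρ : CStarState A) (τ : CStarState B)
    (Y : A) (h : ρ (star Y * Y) ≠ 0) :
    hι.productState (ρ.reduced Y h) τ = (hι.productState ρ τ).reduced (ι (Y ⊗ₜ 1))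
      (by rwa [productState_star_mul_self]) := by
  refine (hι.eq_productState _ _ _ fun a b => ?_).symm
  rw [CStarState.reduced_apply, CStarState.reduced_apply, productState_star_mul_self, ← map_star,
    TensorProduct.star_tmul, star_one, map_tmul_mul, map_tmul_mul, productState_tmul, one_mul,
    mul_one, div_mul_eq_mul_div]

theorem isStarProjection_map_tmul_one {P : A} (hP : IsStarProjection P) :
    IsStarProjection (ι (P ⊗ₜ (1 : B))) := by
  refine ⟨?_, ?_⟩
  · rw [IsIdempotentElem, map_tmul_mul, hP.isIdempotentElem.eq, mul_one]
  · rw [IsSelfAdjoint, ← map_star, TensorProduct.star_tmul, star_one, hP.isSelfAdjoint.star_eq]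

theorem map_one_sub_tmul_one (P : A) :
    ι ((1 - P) ⊗ₜ (1 : B)) = 1 - ι (P ⊗ₜ (1 : B)) := by
  rw [TensorProduct.sub_tmul, map_sub, ← Algebra.TensorProduct.one_def, map_one]

/-- If `ρ' P` approximates `(ρ' ⊗ τ) q` uniformly over all states `ρ'`, and the reduced state `ρ_Y`
(if it exists) takes the value `c` at `P`, then `ρ ⊗ τ` is small on the conjugate of `q - c` by
`Y ⊗ 1`. -/
theorem norm_conjugate_sub_le (hι : IsCStarTensorProduct ι) {P : A} {q : D} {τ : CStarState B}
    {Δ : ℝ} (hM : ∀ ρ : CStarState A, ‖hι.productState ρ τ q - ρ P‖ ≤ Δ) (ρ : CStarState A)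
    (Y : A) {c : ℂ} (hc : ∀ h : ρ (star Y * Y) ≠ 0, ρ.reduced Y h P = c) :
    ‖hι.productState ρ τ (star (ι (Y ⊗ₜ 1)) * (q - algebraMap ℂ D c) * ι (Y ⊗ₜ 1))‖ ≤
      Δ * (ρ (star Y * Y)).re := by
  set ω := hι.productState ρ τ
  by_cases h : ρ (star Y * Y) = 0
  · -- By Cauchy–Schwarz, `ω` vanishes on every conjugate by a null vector.
    have := ω.norm_conjugate_le (ι (Y ⊗ₜ 1)) (q - algebraMap ℂ D c)
    rw [productState_star_mul_self, h] at this
    simpa [h] using this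
  · have h₁ := hM (ρ.reduced Y h)
    have hω : ω (star (ι (Y ⊗ₜ 1)) * ι (Y ⊗ₜ 1)) ≠ 0 := by rwa [productState_star_mul_self]
    have h₂ : hι.productState (ρ.reduced Y h) τ q - ρ.reduced Y h P =
        ω (star (ι (Y ⊗ₜ 1)) * (q - algebraMap ℂ D c) * ι (Y ⊗ₜ 1)) / ρ (star Y * Y) := by
      rw [hc h, ← hι.productState_star_mul_self ρ τ, ← CStarState.reduced_apply ω _ hω, map_sub,
        ← hι.productState_reduced ρ τ Y h, Algebra.algebraMap_eq_smul_one, map_smul,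
        CStarState.map_one, smul_eq_mul, mul_one]
    have h₃ : 0 < (ρ (star Y * Y)).re := lt_of_le_of_ne (ρ.re_star_mul_self_nonneg Y) fun h0 =>
      h (by rw [← ρ.ofReal_re_star_mul_self, ← h0]; simp)
    rw [h₂, norm_div, ← ρ.ofReal_re_star_mul_self, Complex.norm_of_nonneg h₃.le,
      div_le_iff₀ h₃] at h₁
    exact h₁

/-- A projection `q` whose expectations are approximated by those of `P` is close to `P ⊗ 1` in the
GNS seminorm of every product state. -/
theorem re_star_sub_mul_sub_le (hι : IsCStarTensorProduct ι) {P : A} (hP : IsStarProjection P)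
    {q : D} (hq : IsStarProjection q) {τ : CStarState B} {Δ : ℝ}
    (hM : ∀ ρ : CStarState A, ‖hι.productState ρ τ q - ρ P‖ ≤ Δ) (ρ : CStarState A) :
    (hι.productState ρ τ (star (q - ι (P ⊗ₜ 1)) * (q - ι (P ⊗ₜ 1)))).re ≤ Δ := by
  have h₁ := hι.norm_conjugate_sub_le hM ρ P (c := 1) (ρ.reduced_apply_self hP)
  have h₂ := hι.norm_conjugate_sub_le hM ρ (1 - P) (c := 0) (ρ.reduced_one_sub_apply hP)
  have hp := isStarProjection_map_tmul_one (ι := ι) hP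
  rw [map_one_sub_tmul_one, hp.one_sub.isSelfAdjoint.star_eq, hP.one_sub.isSelfAdjoint.star_eq,
    hP.one_sub.isIdempotentElem.eq, map_zero, sub_zero] at h₂
  rw [hp.isSelfAdjoint.star_eq, hP.isSelfAdjoint.star_eq, hP.isIdempotentElem.eq, map_one] at h₁
  set p := ι (P ⊗ₜ (1 : B))
  set ω := hι.productState ρ τ
  have hpp : p * p = p := hp.isIdempotentElem.eq
  have hqq : q * q = q := hq.isIdempotentElem.eq
  have hsplit : star (q - p) * (q - p) = (1 - p) * q * (1 - p) - p * (q - 1) * p := by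
    rw [(hq.isSelfAdjoint.sub hp.isSelfAdjoint).star_eq]
    simp only [mul_sub, sub_mul, one_mul, mul_one, hpp, hqq]
    abel
  rw [hsplit, map_sub, Complex.sub_re]
  rw [map_sub, CStarState.map_one, Complex.sub_re, Complex.one_re] at h₂
  have h₃ := (Complex.re_le_norm _).trans h₂
  have h₄ := (abs_le.1 ((Complex.abs_re_le_norm _).trans h₁)).1
  linarith

end IsCStarTensorProduct

theorem mainTheorem3 {A B D : Type*} [CStarAlgebra A] [CStarAlgebra B] [CStarAlgebra D]
    {ι : A ⊗[ℂ] B →⋆ₐ[ℂ] D} (hι : IsCStarTensorProduct ι)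
    (P : A) (hP : IsStarProjection P) (Q : D) (hQ : IsStarProjection Q)
    (α : D ≃⋆ₐ[ℂ] D) (τ : CStarState B) (Δ : ℝ) (hΔ : 0 ≤ Δ)
    (hM : ∀ ρ : CStarState A, ‖hι.measurement α τ ρ Q - ρ P‖ ≤ Δ)
    (ρ : CStarState A) (hρP : ρ (star P * P) ≠ 0)
    (hρQ : hι.measurement α τ ρ (star Q * Q) ≠ 0) :
    ‖((hι.measurement α τ ρ).reduced Q hρQ).toDual -
        (hι.measurement α τ (ρ.reduced P hρP)).toDual‖ ≤
      Real.sqrt Δ / (hι.measurement α τ ρ Q).re *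
        (1 + 2 * Real.sqrt Δ + Real.sqrt (1 + (1 + 2 * Real.sqrt Δ) ^ 2)) := by
  set ω := hι.productState ρ τ with hω
  set p := ι (P ⊗ₜ (1 : B)) with hp_def
  have hp : IsStarProjection p := IsCStarTensorProduct.isStarProjection_map_tmul_one hP
  have hq : IsStarProjection (α Q) := hQ.map α
  have hωp : ω (star p * p) ≠ 0 := by rwa [hι.productState_star_mul_self]
  have hωq : ω (star (α Q) * α Q) ≠ 0 := by
    rwa [hι.measurement_apply, map_mul, map_star] at hρQ
  have hs : 0 ≤ (ω (α Q)).re := by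
    have := ω.re_star_mul_self_nonneg (α Q)
    rwa [hq.isSelfAdjoint.star_eq, hq.isIdempotentElem.eq] at this
  have hΔ0 := Real.sqrt_nonneg Δ
  have hconst : 2 + √Δ ≤ 1 + 2 * √Δ + √(1 + (1 + 2 * √Δ) ^ 2) := by
    have : 1 ≤ √(1 + (1 + 2 * √Δ) ^ 2) := Real.one_le_sqrt.2 (by nlinarith)
    linarith
  rw [hι.measurement_apply]
  refine ContinuousLinearMap.opNorm_le_bound _ (by positivity) fun x => ?_
  have hl : (hι.measurement α τ ρ).reduced Q hρQ x = ω.reduced (α Q) hωq (α x) := by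
    rw [CStarState.reduced_apply, CStarState.reduced_apply]
    simp only [hι.measurement_apply, map_mul, map_star, hω]
  have hr : hι.measurement α τ (ρ.reduced P hρP) x = ω.reduced p hωp (α x) := by
    rw [hι.measurement_apply, hι.productState_reduced]
  have key := ω.norm_reduced_apply_sub_le hp hq hωp hωq hΔ
    (hι.re_star_sub_mul_sub_le hP hq hM ρ) (by
      rw [hp_def, hω, hι.productState_tmul_one]
      exact hM ρ) (α x)
  rw [NonUnitalStarAlgHom.norm_map α (EquivLike.injective α)] at key
  rw [_root_.sub_apply, CStarState.toDual_apply, CStarState.toDual_apply, hl, hr]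
  exact key.trans (by gcongr)
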